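/- **Setting.** Let $G$ be an abelian group, written additively, with a cyclic order compatible with addition: a ternary relation $R$ that is strict ($R(a,b,c)$ implies $a,b,c$ pairwise distinct), cyclic ($R(a,b,c)\Rightarrow R(b,c,a)$), such that each $R(c,\cdot,\cdot)$ is a strict linear order on $G\setminus\{c\}$, and such that $R(a,b,c)\Rightarrow R(a+u,b+u,c+u)$. Write $R(x_0,\dots,x_m)$ if $R(x_i,x_j,x_k)$ holds for all $i<j<k$. * The *unwound* $\mathrm{uw}(G)$ is the set $\mathbb Z\times G$ with $(m,a)+(n,b)=(m+n+\varepsilon,a+b)$, where $\varepsilon=0$ if $a=0$ or $b=0$ or $R(0,a,a+b)$, and $\varepsilon=1$ otherwise; it is ordered by $(m,a)<(n,b)$ iff $m<n$, or $m=n$ and ($R(0,a,b)$ or $a=0\neq b$). It is a linearly ordered abelian group. * The *linear part* $l(G)$ is the image in $G$, under $(m,a)\mapsto a$, of the greatest proper convex subgroup of $\mathrm{uw}(G)$. The projection is injective on that subgroup, and $l(G)$ carries the transported linear order. $K(G)=G/l(G)$, and $G$ is *c-archimedean* if $l(G)=\{0\}$. The group $K(G)$ is isomorphic to a subgroup of the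 group of complex numbers of modulus $1$; a primitive $n$-th root of $1$ in $K(G)$ is an element of order $n$. * A linearly ordered abelian group $A$ is *$n$-regular* if for all $0<x_1<\dots<x_n$ in $A$ there is $y\in A$ with $x_1\le ny\le x_n$. * $G$ is *c-$n$-regular* if for all $x_1,\dots,x_n\in G$ with $R(0,x_1,\dots,x_n)$ there is $y\in G$ such that ($ny=x_1$ or $ny=x_n$ or $R(x_1,ny,x_n)$) and $R(0,y,2y,\dots,(n-1)y,x_n)$. * An abelian group is *c-$n$-divisible* if it is $n$-divisible and contains a subgroup isomorphic to the group generated by a primitive $n$-th root of $1$ in $\mathbb C$. * A subgroup $H$ of $G$ is *c-convex* if no nonzero $b\in H$ satisfies $b=-b$, and $b\in H$, $R(0,b,-b)$, $R(0,a,b)$ imply $a\in H$. A *proper* c-convex subgroup is a c-convex subgroup $H\ne\{0\}$ such that $H\neq G$, except that $H=G$ is allowed when $l(G)=G$ (equivalently, it is a nontrivial convex subgroup of $l(G)$). **Theorem.** Let $n\ge 2$. The following conditions are equivalent: 1. $\mathrm{uw}(G)$ is $n$-regular; 2. $G$ is c-$n$-regular; 3. either $G$ is c-archimedean, or $l(G)$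 is $n$-regular, $K(G)$ is $n$-divisible and $K(G)$ contains a primitive $n$-th root of $1$; 4. for every proper c-convex subgroup $H$ of $G$, the quotient $G/H$ is c-$n$-divisible. -/

import Mathlib

/-- A cyclically ordered abelian group. The strict cyclic order `R` is Mathlib's `sbtw`
(`CircularOrder` says that `sbtw` is strict, cyclic, and that each `sbtw c` is a strict linear order
on the complement of `c`); this class adds compatibility with the group law. -/
class IsCyclicallyOrderedAddGroup (G : Type*) [AddCommGroup G] [CircularOrder G] : Prop where
  sbtw_add_right : ∀ {a b c : G}, sbtw a b c → ∀ u : G, sbtw (a + u) (b + u) (c + u)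

/-- Divisibility of an abelian group by a natural number. -/
def IsNDivisible (n : ℕ) (A : Type*) [AddCommGroup A] : Prop :=
  ∀ x : A, ∃ y : A, n • y = x

/-- A linearly ordered abelian group is `n`-regular if for all `0 < x₁ < ⋯ < xₙ` there is `y` with
`x₁ ≤ n y ≤ xₙ`. Only the values `x 1, …, x n` of the sequence matter. -/
def IsNRegular (n : ℕ) (A : Type*) [AddCommGroup A] [LinearOrder A] : Prop :=
  ∀ x : ℕ → A, 0 < x 1 → (∀ i j, 1 ≤ i → i < j → j ≤ n → x i < x j) →
    ∃ y : A, x 1 ≤ n • y ∧ n • y ≤ x n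

/-- A subgroup isomorphic to the group generated by a primitive `n`-th root of unity in `ℂ`,
together with `n`-divisibility. -/
def IsCNDivisible (n : ℕ) (A : Type*) [AddCommGroup A] : Prop :=
  IsNDivisible n A ∧ ∃ (S : AddSubgroup A) (ζ : ℂˣ), IsPrimitiveRoot ζ n ∧
    Nonempty (Multiplicative S ≃* Subgroup.zpowers ζ)

/-- The relation `R(x₀, …, xₘ)`: all triples with increasing indices are in cyclic order. -/
def CyclicChain {G : Type*} [CircularOrder G] (m : ℕ) (x : ℕ → G) : Prop :=
  ∀ i j k, i < j → j < k → k ≤ m → sbtw (x i) (x j) (x k)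

/-- `G` is c-`n`-regular if for all `x₁, …, xₙ` with `R(0, x₁, …, xₙ)` there is `y` such that
`n y = x₁` or `n y = xₙ` or `R(x₁, n y, xₙ)`, and `R(0, y, 2 y, …, (n - 1) y, xₙ)`. -/
def IsCNRegular (n : ℕ) (G : Type*) [AddCommGroup G] [CircularOrder G] : Prop :=
  ∀ x : ℕ → G, x 0 = 0 → CyclicChain n x →
    ∃ y : G, (n • y = x 1 ∨ n • y = x n ∨ sbtw (x 1) (n • y) (x n)) ∧
      CyclicChain n (fun i => if i < n then i • y else x n)

/-- The set `ℤ × G` underlying the unwound of `G`. -/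
@[ext]
structure Unwound (G : Type*) where
  level : ℤ
  point : G

namespace Unwound

open Classical in
/-- The integer added to the first coordinate when adding `(m, a)` and `(n, b)`. It is `1` exactly
when `R(0, a + b, a)`, or `a + b = 0 ≠ a`. -/
noncomputable def carry {G : Type*} [AddCommGroup G] [CircularOrder G] (a b : G) : ℤ :=
  if a = 0 then 0 else if b = 0 then 0 else if sbtw 0 a (a + b) then 0 else 1

/-- The linear order on `G` cut at `0`: `0` is the least element, and otherwise `a` precedes `b`
when `R(0, a, b)`. -/
def Prec {G : Type*} [AddCommGroup G] [CircularOrder G] (a b : G) : Prop :=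
  (a = 0 ∧ b ≠ 0) ∨ sbtw 0 a b

section circular

variable {G : Type*} [CircularOrder G]

theorem sbtw_ne {a b c : G} (h : sbtw a b c) : a ≠ b ∧ b ≠ c ∧ c ≠ a :=
  ⟨fun e => sbtw_irrefl_left (e ▸ h), fun e => sbtw_irrefl_right (e ▸ h),
    fun e => sbtw_irrefl_left_right (e ▸ h)⟩

theorem sbtw_or {a b c : G} (h1 : a ≠ b) (h2 : b ≠ c) (h3 : c ≠ a) : sbtw a b c ∨ sbtw c b a := by
  by_contra! h
  have k1 := btw_iff_not_sbtw.2 h.1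
  have k2 := btw_iff_not_sbtw.2 h.2
  rcases btw_antisymm k1 k2 with e | e | e
  · exact h2 e.symm
  · exact h1 e.symm
  · exact h3 e.symm

end circular

section zero

variable {G : Type*} [AddCommGroup G]

instance : Zero (Unwound G) := ⟨⟨0, 0⟩⟩

theorem zero_level : (0 : Unwound G).level = 0 := rfl

theorem zero_point : (0 : Unwound G).point = 0 := rfl

/-- The positive cofinal element `z_G = (1, 0)`. -/
def z (G : Type*) [AddCommGroup G] : Unwound G := ⟨1, 0⟩

end zero

section order

variable {G : Type*} [AddCommGroup G] [CircularOrder G]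

theorem prec_irrefl (a : G) : ¬ Prec a a := by
  rintro (⟨h, h'⟩ | h)
  · exact h' h
  · exact sbtw_irrefl_right h

theorem prec_trans {a b c : G} (h : Prec a b) (h' : Prec b c) : Prec a c := by
  rcases h with ⟨rfl, hb⟩ | h
  · rcases h' with ⟨h1, _⟩ | h'
    · exact absurd h1 hb
    · exact Or.inl ⟨rfl, (sbtw_ne h').2.2⟩
  · rcases h' with ⟨h1, _⟩ | h'
    · exact absurd h1 (sbtw_ne h).2.2
    · exact Or.inr (sbtw_trans_right h h')

theorem prec_total {a b : G} (h : a ≠ b) : Prec a b ∨ Prec b a := by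
  by_cases ha : a = 0
  · subst ha
    exact Or.inl (Or.inl ⟨rfl, h.symm⟩)
  by_cases hb : b = 0
  · subst hb
    exact Or.inr (Or.inl ⟨rfl, h⟩)
  rcases sbtw_or (Ne.symm ha) h hb with k | k
  · exact Or.inl (Or.inr k)
  · exact Or.inr (Or.inr k.cyclic_right.cyclic_right.cyclic_right.cyclic_left.cyclic_left)

theorem not_prec_zero (a : G) : ¬ Prec a 0 := by
  rintro (⟨_, h⟩ | h)
  · exact h rfl
  · exact sbtw_irrefl_left_right h

theorem sbtw_of_prec {x y w : G} (h : Prec x y) (h' : Prec y w) : sbtw x y w := by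
  rcases h' with ⟨rfl, _⟩ | h'
  · exact absurd h (not_prec_zero x)
  rcases h with ⟨rfl, _⟩ | h
  · exact h'
  · exact (sbtw_trans_right h'.cyclic_left h.cyclic_right).cyclic_right

theorem sbtw_iff_prec (x y w : G) : sbtw x y w ↔
    (Prec x y ∧ Prec y w) ∨ (Prec y w ∧ Prec w x) ∨ (Prec w x ∧ Prec x y) := by
  constructor
  · intro h
    obtain ⟨h1, h2, h3⟩ := sbtw_ne h
    have key : ∀ {p q r : G}, sbtw p q r → Prec r q → ¬ Prec q p := fun hs k1 k2 =>
      sbtw_asymm hs (sbtw_of_prec k1 k2)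
    have a1 := @key _ _ _ h
    have a2 := @key _ _ _ h.cyclic_left
    have a3 := @key _ _ _ h.cyclic_right
    have b1 := prec_total h1
    have b2 := prec_total h2
    have b3 := prec_total h3
    tauto
  · rintro (⟨h, h'⟩ | ⟨h, h'⟩ | ⟨h, h'⟩)
    · exact sbtw_of_prec h h'
    · exact (sbtw_of_prec h h').cyclic_right
    · exact (sbtw_of_prec h h').cyclic_left

open Classical in
/-- `1` when the second argument strictly precedes the first one, `0` otherwise. -/
noncomputable def desc (a b : G) : ℤ := if Prec b a then 1 else 0

open Classical in
theorem desc_turn (x y w : G) : desc x y + desc y w - desc x w =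
    if sbtw w y x ∨ (x = w ∧ x ≠ y) then 1 else 0 := by
  have asymm : ∀ {p q : G}, Prec p q → ¬ Prec q p := fun h h' => prec_irrefl _ (prec_trans h h')
  have irr := @prec_irrefl G _ _
  rw [sbtw_iff_prec]
  by_cases e1 : x = y
  · subst e1
    simp only [desc, irr, if_false, false_and, and_false, false_or, ne_eq, not_true, or_false]
    by_cases h : Prec w x
    · simp [h, asymm h]
    · simp [h]
  by_cases e2 : y = w
  · subst e2
    simpa [desc, irr, e1] using fun h : Prec y x => asymm h
  by_cases e3 : x = w
  · subst e3
    rcases prec_total e1 with h | h <;> simp [desc, irr, h, asymm h, e1]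
  rcases prec_total e1 with h | h <;> rcases prec_total e2 with h' | h' <;>
    rcases prec_total e3 with h'' | h'' <;>
    first
    | exact absurd (prec_trans h (prec_trans h' h'')) (irr x)
    | exact absurd (prec_trans h'' (prec_trans h' h)) (irr _)
    | simp [desc, h, h', h'', asymm h, asymm h', asymm h'', e3]

theorem desc_self (a : G) : desc a a = 0 := if_neg (prec_irrefl a)

theorem desc_zero_left (a : G) : desc 0 a = 0 := if_neg (not_prec_zero a)

theorem carry_eq_desc (a b : G) : carry a b = desc a (a + b) := by
  unfold carry
  split_ifs with h1 h2 h3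
  · subst h1
    exact (desc_zero_left _).symm
  · subst h2
    rw [add_zero, desc_self]
  · refine (if_neg fun h => prec_irrefl a (prec_trans (Or.inr h3) h)).symm
  · refine (if_pos ?_).symm
    rcases @prec_total G _ _ (a + b) a (by simpa using h2) with h | ⟨h, _⟩ | h
    · exact h
    · exact absurd h h1
    · exact absurd h h3

theorem carry_bounds (a b : G) : 0 ≤ carry a b ∧ carry a b ≤ 1 := by
  unfold carry
  split_ifs <;> omega

/-- The group law of the unwound. -/
noncomputable instance : Add (Unwound G) :=
  ⟨fun x y => ⟨x.level + y.level + carry x.point y.point, x.point + y.point⟩⟩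

noncomputable instance : Neg (Unwound G) :=
  ⟨fun x => ⟨-x.level - carry x.point (-x.point), -x.point⟩⟩

theorem add_level (x y : Unwound G) :
    (x + y).level = x.level + y.level + carry x.point y.point := rfl

theorem add_point (x y : Unwound G) : (x + y).point = x.point + y.point := rfl

theorem neg_level (x : Unwound G) : (-x).level = -x.level - carry x.point (-x.point) := rfl

theorem neg_point (x : Unwound G) : (-x).point = -x.point := rfl

theorem carry_zero_left (a : G) : carry 0 a = 0 := if_pos rfl

/-- The order of the unwound: `(m, a) < (n, b)` iff `m < n`, or `m = n` and either `R(0, a, b)` or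
`a = 0 ≠ b`. -/
instance : LT (Unwound G) :=
  ⟨fun x y => x.level < y.level ∨ (x.level = y.level ∧ Prec x.point y.point)⟩

theorem lt_def (x y : Unwound G) :
    x < y ↔ x.level < y.level ∨ (x.level = y.level ∧ Prec x.point y.point) := Iff.rfl

instance : LE (Unwound G) := ⟨fun x y => x < y ∨ x = y⟩

theorem le_def (x y : Unwound G) : x ≤ y ↔ x < y ∨ x = y := Iff.rfl

theorem lt_irrefl' (x : Unwound G) : ¬ x < x := by
  rintro (h | ⟨_, h⟩)
  · omega
  · exact prec_irrefl _ h

theorem lt_trans' {x y w : Unwound G} (h : x < y) (h' : y < w) : x < w := by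
  rcases h with h | ⟨h, k⟩ <;> rcases h' with h' | ⟨h', k'⟩
  · exact Or.inl (by omega)
  · exact Or.inl (by omega)
  · exact Or.inl (by omega)
  · exact Or.inr ⟨by omega, prec_trans k k'⟩

open Classical in
noncomputable instance : LinearOrder (Unwound G) where
  le_refl x := Or.inr rfl
  le_trans x y w h h' := by
    rcases h with h | rfl
    · rcases h' with h' | rfl
      · exact Or.inl (lt_trans' h h')
      · exact Or.inl h
    · exact h'
  lt_iff_le_not_ge x y := by
    constructor
    · intro h
      refine ⟨Or.inl h, ?_⟩
      rintro (h' | rfl)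
      · exact lt_irrefl' _ (lt_trans' h h')
      · exact lt_irrefl' _ h
    · rintro ⟨h | rfl, h'⟩
      · exact h
      · exact absurd (Or.inr rfl) h'
  le_antisymm x y h h' := by
    rcases h with h | h
    · rcases h' with h' | h'
      · exact absurd (lt_trans' h h') (lt_irrefl' _)
      · exact h'.symm
    · exact h
  le_total x y := by
    rcases lt_trichotomy x.level y.level with h | h | h
    · exact Or.inl (Or.inl (Or.inl h))
    · by_cases e : x.point = y.point
      · exact Or.inl (Or.inr (Unwound.ext h e))
      · rcases prec_total e with k | k
        · exact Or.inl (Or.inl (Or.inr ⟨h, k⟩))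
        · exact Or.inr (Or.inl (Or.inr ⟨h.symm, k⟩))
    · exact Or.inr (Or.inl (Or.inl h))
  toDecidableLE := Classical.decRel _

theorem z_pos : 0 < z G := Or.inl Int.zero_lt_one

variable [IsCyclicallyOrderedAddGroup G]

theorem sbtw_add_iff (a b c u : G) : sbtw (a + u) (b + u) (c + u) ↔ sbtw a b c := by
  refine ⟨fun h => ?_, fun h => IsCyclicallyOrderedAddGroup.sbtw_add_right h u⟩
  simpa using IsCyclicallyOrderedAddGroup.sbtw_add_right h (-u)

theorem desc_turn_add (x y w u : G) :
    desc (x + u) (y + u) + desc (y + u) (w + u) - desc (x + u) (w + u) =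
      desc x y + desc y w - desc x w := by
  classical
  simp only [desc_turn, sbtw_add_iff, add_left_inj, ne_eq]

theorem carry_assoc (a b c : G) :
    carry a b + carry (a + b) c = carry b c + carry a (b + c) := by
  have h := desc_turn_add 0 b (b + c) a
  simp only [desc_zero_left, zero_add] at h
  simp only [carry_eq_desc]
  rw [add_comm b a, add_comm (b + c) a, ← add_assoc] at h
  rw [← add_assoc]
  omega

theorem carry_comm (a b : G) : carry a b = carry b a := by
  have key : ∀ x y w : G, carry (x + y) w - carry w (x + y) =
      (carry x w - carry w x) + (carry y w - carry w y) := by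
    intro x y w
    have h1 := carry_assoc x y w
    have h2 := carry_assoc w x y
    have h3 := carry_assoc x w y
    rw [add_comm w x] at h2
    rw [add_comm w y] at h3
    omega
  have k1 := key a a (b + b)
  have k2 := key b b a
  have h1 := carry_bounds (a + a) (b + b)
  have h2 := carry_bounds (b + b) (a + a)
  omega

noncomputable instance : AddCommGroup (Unwound G) where
  add_assoc x y w := by
    have h := carry_assoc x.point y.point w.point
    ext
    · simp only [add_level, add_point]
      omega
    · simp only [add_point, add_assoc]
  zero_add x := by
    ext
    · simp [add_level, zero_level, zero_point, carry_zero_left]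
    · simp [add_point, zero_point]
  add_zero x := by
    ext
    · simp [add_level, zero_level, zero_point, carry_comm x.point, carry_zero_left]
    · simp [add_point, zero_point]
  neg_add_cancel x := by
    ext
    · simp only [add_level, neg_level, neg_point, zero_level, carry_comm (-x.point)]
      omega
    · simp [add_point, neg_point, zero_point]
  add_comm x y := by
    ext
    · simp only [add_level, carry_comm x.point]
      omega
    · simp only [add_point, add_comm]
  nsmul := nsmulRec
  zsmul := zsmulRec

theorem add_lt_add_left' {x y : Unwound G} (h : x < y) (w : Unwound G) : w + x < w + y := by
  classical
  set a := x.point with ha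
  set b := y.point with hb
  set c := w.point with hc
  have e1 : carry c a = desc c (c + a) := carry_eq_desc c a
  have e2 : carry c b = desc c (c + b) := carry_eq_desc c b
  have hne : a ≠ b → c + a ≠ c + b := fun h h' => h (add_left_cancel h')
  have t1 := @prec_trans G _ _ (c + a) c (c + b)
  have t2 := @prec_total G _ _ (c + a) (c + b)
  have t3 := @prec_total G _ _ c (c + b)
  rw [lt_def]
  simp only [add_level, add_point, ← ha, ← hb, ← hc, e1, e2]
  rcases h with h | ⟨h, k⟩
  · simp only [desc]
    split_ifs with p q q
    · exact Or.inl (by omega)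
    · have hab : Prec (c + a) (c + b) := by
        by_cases e : c = c + b
        · rw [← e]
          exact p
        · exact t1 p ((t3 e).resolve_right q)
      by_cases l : x.level + 1 = y.level
      · exact Or.inr ⟨by omega, hab⟩
      · exact Or.inl (by omega)
    · exact Or.inl (by omega)
    · exact Or.inl (by omega)
  · rw [← ha, ← hb] at k
    have hab : a ≠ b := fun e => prec_irrefl b (e ▸ k)
    have hd := desc_turn_add 0 a b c
    have h0 : desc a b = 0 := if_neg fun k' => prec_irrefl a (prec_trans k k')
    rw [desc_zero_left, desc_zero_left, h0, zero_add, add_comm a c, add_comm b c] at hd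
    by_cases q : Prec (c + b) (c + a)
    · have h1 : desc (c + a) (c + b) = 1 := if_pos q
      exact Or.inl (by omega)
    · have h1 : desc (c + a) (c + b) = 0 := if_neg q
      exact Or.inr ⟨by omega, (t2 (hne hab)).resolve_right q⟩

instance : IsOrderedAddMonoid (Unwound G) where
  add_le_add_left x y h w := by
    rw [add_comm x w, add_comm y w]
    rcases h with h | rfl
    · exact Or.inl (add_lt_add_left' h w)
    · exact Or.inr rfl

/-- The projection `(m, a) ↦ a`, with kernel generated by `z_G`. -/
def proj (G : Type*) [AddCommGroup G] [CircularOrder G] [IsCyclicallyOrderedAddGroup G] :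
    Unwound G →+ G where
  toFun := Unwound.point
  map_zero' := rfl
  map_add' _ _ := rfl

theorem nsmul_z (k : ℕ) : k • z G = ⟨k, 0⟩ := by
  induction k with
  | zero => rw [zero_smul]; rfl
  | succ k ih =>
    rw [succ_nsmul, ih]
    ext
    · simp [add_level, z, carry_zero_left]
    · simp [add_point, z]

theorem exists_lt_nsmul_z (x : Unwound G) : ∃ k : ℕ, x < k • z G := by
  refine ⟨x.level.toNat + 1, ?_⟩
  rw [nsmul_z]
  exact Or.inl (by push_cast; omega)

/-- Convex subgroups of a linearly ordered group. -/
def IsConvex {A : Type*} [AddCommGroup A] [LinearOrder A] (H : AddSubgroup A) : Prop :=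
  ∀ x y : A, x ∈ H → 0 ≤ y → y ≤ x → y ∈ H

/-- The greatest proper convex subgroup of the unwound (see `isGreatest_convexPart`). -/
noncomputable def convexPart (G : Type*) [AddCommGroup G] [CircularOrder G]
    [IsCyclicallyOrderedAddGroup G] : AddSubgroup (Unwound G) :=
  sSup {H | IsConvex H ∧ H ≠ ⊤}

/-- The subgroup of the elements of the unwound that are infinitely small with respect to `z_G`. -/
def infinitesimals (G : Type*) [AddCommGroup G] [CircularOrder G]
    [IsCyclicallyOrderedAddGroup G] : AddSubgroup (Unwound G) where
  carrier := {x | ∀ k : ℤ, k • x < z G}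
  zero_mem' k := by
    rw [smul_zero]
    exact z_pos
  neg_mem' {x} hx k := by
    have h := hx (-k)
    rwa [neg_smul, ← smul_neg] at h
  add_mem' {x y} hx hy k := by
    rw [smul_add]
    rcases le_total (k • x) (k • y) with h | h
    · refine lt_of_le_of_lt (add_le_add_left h _) ?_
      have := hy (2 * k)
      rwa [mul_smul, two_smul] at this
    · refine lt_of_le_of_lt (add_le_add_right h _) ?_
      have := hx (2 * k)
      rwa [mul_smul, two_smul] at this

theorem mem_infinitesimals (x : Unwound G) : x ∈ infinitesimals G ↔ ∀ k : ℤ, k • x < z G := Iff.rfl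

theorem isGreatest_infinitesimals :
    IsGreatest {H : AddSubgroup (Unwound G) | IsConvex H ∧ H ≠ ⊤} (infinitesimals G) := by
  refine ⟨⟨?_, ?_⟩, ?_⟩
  · intro x y hx h0 hyx k
    rcases le_total k 0 with hk | hk
    · refine lt_of_le_of_lt ?_ z_pos
      have := zsmul_nonneg h0 (neg_nonneg.2 hk)
      rw [neg_smul] at this
      exact neg_nonneg.1 this
    · exact lt_of_le_of_lt (zsmul_le_zsmul_right hk hyx) (hx k)
  · intro h
    have : z G ∈ infinitesimals G := h ▸ AddSubgroup.mem_top _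
    have := this 1
    rw [one_smul] at this
    exact lt_irrefl _ this
  · rintro H ⟨hc, hne⟩ x hx k
    by_contra! hk
    apply hne
    have hz : z G ∈ H := hc _ _ (H.zsmul_mem hx k) z_pos.le hk
    have hpos : ∀ y : Unwound G, 0 ≤ y → y ∈ H := by
      intro y hy
      obtain ⟨m, hm⟩ := exists_lt_nsmul_z y
      exact hc _ _ (H.nsmul_mem hz m) hy hm.le
    rw [eq_top_iff]
    intro y _
    rcases le_total 0 y with h | h
    · exact hpos y h
    · exact neg_neg y ▸ H.neg_mem (hpos _ (neg_nonneg.2 h))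

theorem convexPart_eq : convexPart G = infinitesimals G :=
  isGreatest_infinitesimals.isLUB.sSup_eq

theorem isGreatest_convexPart :
    IsGreatest {H : AddSubgroup (Unwound G) | IsConvex H ∧ H ≠ ⊤} (convexPart G) :=
  convexPart_eq (G := G) ▸ isGreatest_infinitesimals

theorem proj_injective : Function.Injective ((proj G).comp (convexPart G).subtype) := by
  rw [injective_iff_map_eq_zero]
  rintro ⟨x, hx⟩ h
  rw [convexPart_eq, mem_infinitesimals] at hx
  have hp : x.point = 0 := h
  have h1 := hx 1
  have h2 := hx (-1)
  rw [neg_smul, one_smul] at h2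
  rw [one_smul] at h1
  have hl : x.level = 0 := by
    have c0 : carry (0 : G) 0 = 0 := carry_zero_left 0
    have z0 : ¬ Prec (0 : G) 0 := prec_irrefl 0
    rw [lt_def] at h1 h2
    simp only [neg_level, neg_point, hp, neg_zero, z, c0, z0, and_false, or_false] at h1 h2
    omega
  exact Subtype.ext (Unwound.ext hl hp)

end order

end Unwound

section linearPart

variable (G : Type*) [AddCommGroup G] [CircularOrder G] [IsCyclicallyOrderedAddGroup G]

/-- The linear part `l(G)`: the image in `G` of the greatest proper convex subgroup of the
unwound. -/
noncomputable def linearPart : AddSubgroup G :=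
  ((Unwound.proj G).comp (Unwound.convexPart G).subtype).range

/-- The isomorphism from the greatest proper convex subgroup of the unwound onto `l(G)`. -/
noncomputable def linearPartEquiv : Unwound.convexPart G ≃+ linearPart G :=
  AddMonoidHom.ofInjective Unwound.proj_injective

/-- The linear order of `l(G)` is transported from the unwound. -/
noncomputable instance : LinearOrder (linearPart G) :=
  LinearOrder.lift' (linearPartEquiv G).symm (linearPartEquiv G).symm.injective

instance : IsOrderedAddMonoid (linearPart G) where
  add_le_add_left x y h w := by
    change (linearPartEquiv G).symm (x + w) ≤ (linearPartEquiv G).symm (y + w)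
    rw [map_add, map_add]
    exact add_le_add_left (α := Unwound.convexPart G) h _

/-- `G` is c-archimedean when its linear part is trivial. -/
def IsCArchimedean : Prop := linearPart G = ⊥

variable {G}

/-- A c-convex subgroup: no nonzero element is its own opposite, and `b ∈ H`, `R(0, b, -b)`,
`R(0, a, b)` imply `a ∈ H`. -/
def IsCConvex (H : AddSubgroup G) : Prop :=
  (∀ b ∈ H, b ≠ 0 → b ≠ -b) ∧ ∀ a b : G, b ∈ H → sbtw 0 b (-b) → sbtw 0 a b → a ∈ H

/-- A proper c-convex subgroup: it is nontrivial, and it is distinct from `G` unless `G` is linearly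
cyclically ordered, that is, unless `l(G) = G`. These subgroups are the nontrivial convex subgroups
of `l(G)`. -/
def IsProperCConvex (H : AddSubgroup G) : Prop :=
  IsCConvex H ∧ H ≠ ⊥ ∧ (H = ⊤ → linearPart G = ⊤)

end linearPart

/-! The unifying condition is that $U=\mathrm{uw}(G)$ is $n$-divisible modulo $H$ for every nonzero
convex subgroup $H$. For any linearly ordered group this is equivalent to $n$-regularity
(`IsNRegular.isNDivisibleMod`, `isNRegular_of_isNDivisibleMod`).

A convex $H\ne U$ consists of elements infinitely small with respect to $z=z_G$, and $U/H$ is an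
extension of $G/\mathrm{proj}(H)$ by the infinite cyclic group generated by $z$. Dividing $z$ by $n$
in $U/H$ amounts to finding an element of order $n$ in $G/\mathrm{proj}(H)$, and the other elements
lift from that quotient; this is `Unwound.isNDivisibleMod_iff`. As the proper c-convex subgroups of
$G$ are exactly the images of the nonzero proper convex subgroups of $U$
(`Unwound.isProperCConvex_map`, `Unwound.exists_convex_of_isProperCConvex`), condition 4 is the
unifying condition.

Condition 3 splits it in two: division modulo the largest proper convex subgroup, then division
inside that subgroup. Condition 2 follows from 1 by reading the inequalities inside $[0,z)$.
Conversely, testing c-$n$-regularity on progressions with infinitely small step gives divisibility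
modulo each $H$ (`Unwound.isNDivisibleMod_of_isCNRegular`). -/

/-- Every element of `A` is a multiple of `n` modulo the subgroup `H`. -/
def IsNDivisibleMod {A : Type*} [AddCommGroup A] (n : ℕ) (H : AddSubgroup A) : Prop :=
  ∀ x : A, ∃ y : A, x - n • y ∈ H

/-! ### Regularity of ordered groups through divisibility modulo convex subgroups. -/

section orderedGroup

open Unwound (IsConvex)

variable {A : Type*} [AddCommGroup A] [LinearOrder A] [IsOrderedAddMonoid A]

/-- Division with remainder by `e`; the bound on `|x|` replaces an archimedean hypothesis. -/
theorem exists_zsmul_le_lt {e x : A} {k : ℕ} (he : 0 < e) (h : |x| ≤ k • e) :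
    ∃ m : ℤ, m • e ≤ x ∧ x < (m + 1) • e := by
  obtain ⟨h1, h2⟩ := abs_le.1 h
  have bdd : ∃ b : ℤ, ∀ m : ℤ, m • e ≤ x → m ≤ b := by
    refine ⟨k, fun m hm => (zsmul_le_zsmul_iff_left he).1 ?_⟩
    rw [natCast_zsmul]
    exact hm.trans h2
  obtain ⟨m, hm, hm'⟩ := Int.exists_greatest_of_bdd bdd
    ⟨-k, by rwa [neg_smul, natCast_zsmul]⟩
  exact ⟨m, hm, not_le.1 fun h => by have := hm' _ h; omega⟩

theorem isConvex_closedBall (c : ArchimedeanClass A) :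
    IsConvex (ArchimedeanClass.closedBallAddSubgroup c) := by
  intro x y hx h0 hyx
  rw [ArchimedeanClass.mem_closedBallAddSubgroup_iff] at hx ⊢
  exact hx.trans (ArchimedeanClass.mk_antitoneOn h0 (h0.trans hyx) hyx)

theorem isConvex_ball {c : ArchimedeanClass A} (hc : c ≠ ⊤) :
    IsConvex (ArchimedeanClass.ballAddSubgroup c) := by
  intro x y hx h0 hyx
  rw [ArchimedeanClass.mem_ballAddSubgroup_iff hc] at hx ⊢
  exact hx.trans_le (ArchimedeanClass.mk_antitoneOn h0 (h0.trans hyx) hyx)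

theorem Unwound.IsConvex.mem_of_le {H : AddSubgroup A} (hH : IsConvex H) {a b x : A} (ha : a ∈ H)
    (hb : b ∈ H) (h1 : a ≤ x) (h2 : x ≤ b) : x ∈ H := by
  have := hH (b - a) (x - a) (H.sub_mem hb ha) (sub_nonneg.2 h1) (sub_le_sub_right h2 a)
  simpa using H.add_mem this ha

/-- Quotients by convex subgroups are torsion-free, because $0\le y\le ky$ when $y\ge 0$ and $k\ge
1$. -/
theorem Unwound.IsConvex.mem_of_nsmul_mem {H : AddSubgroup A} (hH : IsConvex H) {k : ℕ} (hk : k ≠ 0)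
    {x : A} (hx : k • x ∈ H) : x ∈ H := by
  have key : ∀ y : A, 0 ≤ y → k • y ∈ H → y ∈ H := fun y h0 hy =>
    hH _ _ hy h0 (by simpa using nsmul_le_nsmul_left h0 (Nat.one_le_iff_ne_zero.2 hk))
  rcases le_total 0 x with h | h
  · exact key x h hx
  · simpa using key (-x) (neg_nonneg.2 h) (by simpa using hx)

theorem exists_pos_mem {H : AddSubgroup A} (hH : H ≠ ⊥) : ∃ h ∈ H, 0 < h := by
  obtain ⟨x, hx, h0⟩ := H.bot_or_exists_ne_zero.resolve_left hH
  rcases lt_or_gt_of_ne h0 with h | h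
  · exact ⟨-x, H.neg_mem hx, neg_pos.2 h⟩
  · exact ⟨x, hx, h⟩

theorem IsNRegular.isNDivisibleMod {n : ℕ} (hA : IsNRegular n A) {H : AddSubgroup A}
    (hH : IsConvex H) (hne : H ≠ ⊥) : IsNDivisibleMod n H := by
  obtain ⟨h, hh, hpos⟩ := exists_pos_mem hne
  have key : ∀ x : A, 0 ≤ x → ∃ y : A, x - n • y ∈ H := by
    intro x hx
    -- The progression $x+h,\dots,x+nh$ stays in one coset of $H$, so any multiple of $n$ trapped in
    -- it is congruent to $x$.
    obtain ⟨y, h1, h2⟩ := hA (fun i => x + i • h) (by simpa using add_pos_of_nonneg_of_pos hx hpos)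
      fun i j _ hij _ => add_lt_add_right (nsmul_lt_nsmul_left hpos hij) x
    refine ⟨y, ?_⟩
    rw [← neg_sub]
    refine H.neg_mem (hH.mem_of_le (H.zero_mem) (H.nsmul_mem hh n) ?_ (sub_le_iff_le_add'.2 h2))
    exact sub_nonneg.2 ((le_add_of_nonneg_right (nsmul_nonneg hpos.le 1)).trans h1)
  intro x
  rcases le_total 0 x with h | h
  · exact key x h
  · obtain ⟨y, hy⟩ := key (-x) (neg_nonneg.2 h)
    exact ⟨-y, by simpa [← neg_add', add_comm] using H.neg_mem hy⟩

theorem exists_pos_nsmul_le_of_strictMono {n : ℕ} (hn : 2 ≤ n) {x : ℕ → A}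
    (hx : ∀ i j, 1 ≤ i → i < j → j ≤ n → x i < x j) :
    ∃ e : A, 0 < e ∧ (n - 1) • e ≤ x n - x 1 := by
  induction n, hn using Nat.le_induction with
  | base => exact ⟨x 2 - x 1, sub_pos.2 (hx 1 2 le_rfl one_lt_two le_rfl), by simp⟩
  | succ k hk ih =>
    obtain ⟨e, he, h⟩ := ih fun i j h1 h2 h3 => hx i j h1 h2 (h3.trans k.le_succ)
    have hd : 0 < x (k + 1) - x k := sub_pos.2 (hx k (k + 1) (by omega) k.lt_succ_self le_rfl)
    -- The witness is the least of the $n-1$ consecutive gaps.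
    refine ⟨min e (x (k + 1) - x k), lt_min he hd, ?_⟩
    have h1 : (k - 1) • min e (x (k + 1) - x k) ≤ x k - x 1 :=
      (nsmul_le_nsmul_right (min_le_left _ _) _).trans h
    have : k + 1 - 1 = (k - 1) + 1 := by omega
    rw [this, succ_nsmul]
    refine (add_le_add h1 (min_le_right e _)).trans_eq ?_
    abel

/-- Modulo $H$, which is negligible against $d$, take $e=d/n$ and $ny=a+e$. Since $e$ sits well
inside $(0,d)$, the errors in $H$ cannot push $ny$ out of $[a,a+d]$. Both bounds are checked after
multiplication by $n$. -/
theorem exists_nsmul_mem_Icc_of_isNDivisibleMod {n : ℕ} (hn : 2 ≤ n) {a d : A} (hd : 0 < d)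
    {H : AddSubgroup A} (hH : IsNDivisibleMod n H) (hs : ∀ h ∈ H, h < d) :
    ∃ y : A, a ≤ n • y ∧ n • y ≤ a + d := by
  have hn0 : n ≠ 0 := by omega
  obtain ⟨e, he⟩ := hH d
  obtain ⟨y, hy⟩ := hH (a + e)
  refine ⟨y, ?_, ?_⟩
  · have h1 := hs _ (H.add_mem he (H.nsmul_mem hy n))
    have h2 : n • (a - n • y) < 0 := by
      rw [← add_lt_iff_neg_left (a := d)]
      convert h1 using 1
      simp only [smul_add, smul_sub]
      abel
    contrapose! h2
    exact nsmul_nonneg (sub_nonneg.2 h2.le) n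
  · have h1 := hs _ (H.neg_mem (H.add_mem he (H.nsmul_mem hy n)))
    have h2 : n • (n • y - a) < n • d := by
      refine lt_of_lt_of_le ?_ (nsmul_le_nsmul_left hd.le hn)
      rw [two_nsmul, ← sub_lt_iff_lt_add]
      convert h1 using 1
      simp only [smul_add, smul_sub]
      abel
    exact sub_le_iff_le_add'.1 (lt_of_nsmul_lt_nsmul_right _ h2).le

theorem exists_nsmul_mem_Icc_of_archimedean {n : ℕ} (hn : 2 ≤ n) {a d e : A} (he : 0 < e)
    (hed : (n - 1) • e ≤ d) (harch : ∀ p : A, 0 < p → ∃ k : ℕ, d ≤ k • p)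
    (hdiv : ∃ (y : A) (k : ℕ), |a - n • y| ≤ k • d) :
    ∃ y : A, a ≤ n • y ∧ n • y ≤ a + d := by
  obtain ⟨y, k, hy⟩ := hdiv
  have hbd : ∀ p : A, 0 < p → ∃ m : ℤ, m • p ≤ a - n • y ∧ a - n • y < (m + 1) • p := by
    intro p hp
    obtain ⟨l, hl⟩ := harch p hp
    refine exists_zsmul_le_lt hp (k := k * l) (hy.trans ?_)
    rw [mul_smul]
    exact nsmul_le_nsmul_right hl k
  -- Either some positive $p$ satisfies $np\le d$, and a multiple of $np$ can be added to $ny$ to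
  -- land in the interval, or the order is discrete at the scale of $d$.
  by_cases hp : ∃ p : A, 0 < p ∧ n • p ≤ d
  · obtain ⟨p, hp, hpd⟩ := hp
    obtain ⟨m, h1, h2⟩ := hbd (n • p) (nsmul_pos hp (by omega))
    refine ⟨y + (m + 1) • p, ?_, ?_⟩
    · rw [smul_add, smul_comm]
      exact sub_le_iff_le_add'.1 h2.le
    · rw [smul_add, smul_comm, add_smul, one_smul, ← add_assoc]
      refine add_le_add ?_ hpd
      rw [add_comm]
      exact le_sub_iff_add_le.1 h1
  · push Not at hp
    obtain ⟨m, h1, h2⟩ := hbd e he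
    -- Here $e$ behaves as a least positive element: a remainder $0<r<e$ would give
    -- $ne=nr+n(e-r)>2d\ge 2(n-1)e\ge ne$.
    have hm : a - n • y = m • e := by
      by_contra hne
      set r := a - n • y - m • e with hr
      have hr0 : 0 < r := sub_pos.2 (lt_of_le_of_ne h1 (Ne.symm hne))
      have hr1 : 0 < e - r := by
        rw [add_smul, one_smul] at h2
        exact sub_pos.2 (sub_lt_iff_lt_add'.2 h2)
      have h3 := add_lt_add (hp r hr0) (hp _ hr1)
      rw [← smul_add, add_sub_cancel] at h3
      refine absurd (h3.trans_le ?_) (lt_irrefl (d + d))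
      refine le_trans ?_ (add_le_add hed hed)
      rw [← add_smul]
      exact nsmul_le_nsmul_left he.le (by omega)
    -- Among the $n$ consecutive integers $m,\dots,m+n-1$ one is a multiple of $n$.
    obtain ⟨q, hq1, hq2⟩ : ∃ q : ℤ, m ≤ n * q ∧ n * q ≤ m + (n - 1) := by
      refine ⟨(m + (n - 1)) / n, ?_, Int.mul_ediv_self_le (by omega)⟩
      have := Int.lt_mul_ediv_self_add (x := m + (n - 1)) (k := n) (by omega)
      omega
    refine ⟨y + q • e, ?_, ?_⟩
    · rw [smul_add, ← natCast_zsmul, ← natCast_zsmul (q • e), smul_smul, natCast_zsmul]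
      refine sub_le_iff_le_add'.1 (hm ▸ ?_)
      exact (zsmul_le_zsmul_iff_left he).2 hq1
    · have : n • (y + q • e) ≤ n • y + (m + (n - 1)) • e := by
        rw [smul_add, ← natCast_zsmul, ← natCast_zsmul (q • e), smul_smul, natCast_zsmul]
        exact add_le_add_right ((zsmul_le_zsmul_iff_left he).2 hq2) _
      refine this.trans ?_
      rw [add_smul, ← hm, ← add_assoc, add_sub_cancel]
      refine add_le_add_right ?_ a
      have hc : ((n : ℤ) - 1) = ((n - 1 : ℕ) : ℤ) := by omega
      rw [hc, natCast_zsmul]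
      exact hed

theorem isNRegular_of_isNDivisibleMod {n : ℕ} (hn : 2 ≤ n)
    (h : ∀ H : AddSubgroup A, IsConvex H → H ≠ ⊥ → IsNDivisibleMod n H) : IsNRegular n A := by
  intro x _ hx
  set d := x n - x 1 with hd
  have hd0 : 0 < d := sub_pos.2 (hx 1 n le_rfl (by omega) le_rfl)
  have hxn : x n = x 1 + d := by rw [hd, add_sub_cancel]
  rw [hxn]
  have htop : ArchimedeanClass.mk d ≠ ⊤ := by simpa using hd0.ne'
  -- The ball is the convex subgroup of elements infinitely smaller than $d$. If it is trivial, $d$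
  -- is archimedean over every positive element, and the closed ball of elements bounded by
  -- multiples of $d$ is used instead.
  by_cases hb : ArchimedeanClass.ballAddSubgroup (ArchimedeanClass.mk d) = ⊥
  · obtain ⟨e, he, hed⟩ := exists_pos_nsmul_le_of_strictMono hn hx
    refine exists_nsmul_mem_Icc_of_archimedean hn he hed ?_ ?_
    · intro p hp
      have hpb : p ∉ ArchimedeanClass.ballAddSubgroup (ArchimedeanClass.mk d) := by
        rw [hb, AddSubgroup.mem_bot]
        exact hp.ne'
      rw [ArchimedeanClass.mem_ballAddSubgroup_iff htop, not_lt, ArchimedeanClass.mk_le_mk,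
        abs_of_pos hp, abs_of_pos hd0] at hpb
      exact hpb
    · have hmem : d ∈ ArchimedeanClass.closedBallAddSubgroup (ArchimedeanClass.mk d) :=
        ArchimedeanClass.mem_closedBallAddSubgroup_iff.2 le_rfl
      obtain ⟨y, hy⟩ := h _ (isConvex_closedBall (ArchimedeanClass.mk d))
        (fun hbot => hd0.ne' (by rwa [hbot, AddSubgroup.mem_bot] at hmem)) (x 1)
      rw [ArchimedeanClass.mem_closedBallAddSubgroup_iff, ArchimedeanClass.mk_le_mk,
        abs_of_pos hd0] at hy
      exact ⟨y, hy⟩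
  · refine exists_nsmul_mem_Icc_of_isNDivisibleMod hn hd0 (h _ (isConvex_ball htop) hb) ?_
    intro p hp
    rw [ArchimedeanClass.mem_ballAddSubgroup_iff htop] at hp
    exact ArchimedeanClass.lt_of_mk_lt_mk_of_nonneg hp hd0.le

end orderedGroup

/-! ### Roots of unity as elements of order $n$. -/

section cyclicSubgroup

theorem isCNDivisible_iff {n : ℕ} (hn : n ≠ 0) {A : Type*} [AddCommGroup A] :
    IsCNDivisible n A ↔ IsNDivisible n A ∧ ∃ t : A, addOrderOf t = n := by
  refine and_congr_right fun _ => ⟨?_, ?_⟩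
  · rintro ⟨S, ζ, hζ, ⟨e⟩⟩
    refine ⟨(e.symm ⟨ζ, Subgroup.mem_zpowers ζ⟩).toAdd, ?_⟩
    rw [AddSubgroup.addOrderOf_coe, ← orderOf_ofAdd_eq_addOrderOf, ofAdd_toAdd,
      MulEquiv.orderOf_eq, Subgroup.orderOf_mk, hζ.eq_orderOf]
  · rintro ⟨t, ht⟩
    have h := Complex.isPrimitiveRoot_exp n hn
    have hu := h.isUnit_unit hn
    refine ⟨AddSubgroup.zmultiples t, _, hu, ⟨mulEquivOfCyclicCardEq ?_⟩⟩
    rw [Nat.card_zpowers, ← hu.eq_orderOf, Nat.card_congr Multiplicative.toAdd,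
      Nat.card_zmultiples, ht]

end cyclicSubgroup

/-! ### Passing between an ordered group and a convex subgroup. -/

section embedding

open Unwound (IsConvex)

variable {A B : Type*} [AddCommGroup A] [LinearOrder A] [IsOrderedAddMonoid A]
  [AddCommGroup B] [LinearOrder B]

theorem IsNRegular.of_isConvex_range {n : ℕ} (hn : 2 ≤ n) (hA : IsNRegular n A) {φ : B →+ A}
    (hφ : StrictMono φ) (hr : IsConvex φ.range) : IsNRegular n B := by
  intro x h0 hx
  obtain ⟨y, h1, h2⟩ := hA (fun i => φ (x i)) (by simpa using hφ h0)
    fun i j h1 h2 h3 => hφ (hx i j h1 h2 h3)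
  have h0' : 0 ≤ n • y := le_trans (by simpa using (hφ h0).le) h1
  have hny : n • y ∈ φ.range := hr _ _ ⟨x n, rfl⟩ h0' h2
  obtain ⟨w, rfl⟩ := hr.mem_of_nsmul_mem (by omega) hny
  rw [← map_nsmul] at h1 h2
  exact ⟨w, hφ.le_iff_le.1 h1, hφ.le_iff_le.1 h2⟩

variable [IsOrderedAddMonoid B]

/-- Two-stage division: first modulo the image of $B$, then the remainder is divided inside $B$
modulo the preimage of $H$. -/
theorem IsNRegular.isNDivisibleMod_of_range {n : ℕ} (hB : IsNRegular n B) {φ : B →+ A}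
    (hφ : StrictMono φ) (hd : IsNDivisibleMod n φ.range) {H : AddSubgroup A}
    (hH : IsConvex H) (hle : H ≤ φ.range) (hne : H ≠ ⊥) : IsNDivisibleMod n H := by
  have hc : IsConvex (H.comap φ) := fun x y hx h0 hyx =>
    hH (φ x) (φ y) hx (by simpa using hφ.monotone h0) (hφ.monotone hyx)
  have hne' : H.comap φ ≠ ⊥ := by
    obtain ⟨h, hh, h0⟩ := exists_pos_mem hne
    obtain ⟨b, rfl⟩ := hle hh
    intro e
    have hb : b ∈ H.comap φ := hh
    rw [e, AddSubgroup.mem_bot] at hb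
    simp [hb] at h0
  intro x
  obtain ⟨y, b, hb⟩ := hd x
  obtain ⟨c, hc⟩ := hB.isNDivisibleMod hc hne' b
  refine ⟨y + φ c, ?_⟩
  have : φ (b - n • c) ∈ H := hc
  rw [map_sub, map_nsmul, hb] at this
  rwa [smul_add, ← sub_sub]

end embedding

/-! ### Lifting to $[0,z)$ and divisibility of quotients. -/

namespace Unwound

variable {G : Type*} [AddCommGroup G] [CircularOrder G]

/-- The representative of `a` in the interval `[0, z_G)`. -/
def lift (a : G) : Unwound G := ⟨0, a⟩

theorem lift_lt_lift {a b : G} : lift a < lift b ↔ Prec a b := by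
  simp [lt_def, lift]

theorem lift_zero {G : Type*} [AddCommGroup G] : lift (0 : G) = 0 := rfl

theorem sbtw_of_lift_lt {a b c : G} (h : lift a < lift b) (h' : lift b < lift c) : sbtw a b c :=
  sbtw_of_prec (lift_lt_lift.1 h) (lift_lt_lift.1 h')

theorem sbtw_zero_iff {a b : G} : sbtw 0 a b ↔ 0 < lift a ∧ lift a < lift b := by
  constructor
  · intro h
    rw [← lift_zero, lift_lt_lift, lift_lt_lift]
    exact ⟨Or.inl ⟨rfl, (sbtw_ne h).1.symm⟩, Or.inr h⟩
  · rintro ⟨h, h'⟩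
    exact sbtw_of_lift_lt (lift_zero (G := G) ▸ h) h'

theorem lift_nonneg (a : G) : 0 ≤ lift a := by
  by_cases h : a = 0
  · subst h
    exact le_rfl
  · exact Or.inl (Or.inr ⟨rfl, Or.inl ⟨rfl, h⟩⟩)

theorem lift_lt_z (a : G) : lift a < z G := Or.inl Int.zero_lt_one

theorem lift_point {x : Unwound G} (h0 : 0 ≤ x) (h1 : x < z G) : lift x.point = x := by
  refine Unwound.ext ?_ rfl
  have h2 : x.level ≤ 0 := by
    rcases h1 with h | ⟨_, h⟩
    · exact Int.lt_add_one_iff.1 h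
    · exact absurd h (not_prec_zero _)
  have h3 : 0 ≤ x.level := by
    rcases h0 with (h | ⟨h, _⟩) | h
    · exact h.le
    · exact h.le
    · exact h ▸ le_rfl
  exact le_antisymm h3 h2

theorem cyclicChain_of_lift_lt {m : ℕ} {x : ℕ → G}
    (h : ∀ i j, i < j → j ≤ m → lift (x i) < lift (x j)) : CyclicChain m x :=
  fun i j k hij hjk hk => sbtw_of_lift_lt (h i j hij (hjk.le.trans hk)) (h j k hjk hk)

theorem lift_add_of_sbtw {a b : G} (h : sbtw 0 a (a + b)) : lift (a + b) = lift a + lift b := by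
  refine Unwound.ext ?_ rfl
  simp [add_level, lift, carry, h]

theorem lift_add_or (a b : G) :
    lift a + lift b = lift (a + b) ∨ lift a + lift b = z G + lift (a + b) := by
  have h := carry_bounds a b
  have h' : carry a b = 0 ∨ carry a b = 1 := by omega
  refine h'.imp (fun h => Unwound.ext ?_ rfl) fun h => Unwound.ext ?_ ?_
  · simp [add_level, lift, h]
  · simp [add_level, lift, h, z, carry_zero_left]
  · simp [add_point, lift, z]

variable [IsCyclicallyOrderedAddGroup G]

theorem zsmul_z (k : ℤ) : k • z G = ⟨k, 0⟩ := by
  rcases k.eq_nat_or_neg with ⟨m, rfl | rfl⟩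
  · rw [natCast_zsmul, nsmul_z]
  · rw [neg_smul, natCast_zsmul, nsmul_z]
    ext
    · simp [neg_level, carry_zero_left]
    · simp [neg_point]

theorem proj_z : proj G (z G) = 0 := rfl

theorem proj_lift (a : G) : proj G (lift a) = a := rfl

theorem eq_zsmul_z_of_proj_eq_zero {x : Unwound G} (h : proj G x = 0) : x = x.level • z G := by
  rw [zsmul_z]
  exact Unwound.ext rfl h

theorem proj_mem_map_iff {H : AddSubgroup (Unwound G)} {x : Unwound G} :
    proj G x ∈ H.map (proj G) ↔ ∃ k : ℤ, x - k • z G ∈ H := by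
  constructor
  · rintro ⟨h, hh, e⟩
    refine ⟨(x - h).level, ?_⟩
    rw [← eq_zsmul_z_of_proj_eq_zero (by rw [map_sub, e, sub_self])]
    simpa using hh
  · rintro ⟨k, hk⟩
    exact ⟨_, hk, by rw [map_sub, map_zsmul, proj_z, smul_zero, sub_zero]⟩

theorem eq_zero_of_zsmul_z_mem {k : ℤ} (h : k • z G ∈ infinitesimals G) : k = 0 := by
  have h1 := h k
  rw [smul_smul] at h1
  nth_rw 2 [← one_zsmul (z G)] at h1
  have h2 := (zsmul_lt_zsmul_iff_left z_pos).1 h1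
  by_contra hk
  have := mul_self_pos.2 hk
  omega

theorem exists_zsmul_z_add_lift (x : Unwound G) : ∃ (k : ℤ) (a : G), x = k • z G + lift a := by
  refine ⟨x.level, x.point, ?_⟩
  rw [zsmul_z]
  ext
  · simp [add_level, lift, carry_zero_left]
  · simp [add_point, lift]

theorem isNDivisibleMod_iff {n : ℕ} (hn : n ≠ 0) {H : AddSubgroup (Unwound G)} (hH : IsConvex H)
    (hle : H ≤ infinitesimals G) :
    IsNDivisibleMod n H ↔ IsNDivisible n (G ⧸ H.map (proj G)) ∧
      ∃ t : G ⧸ H.map (proj G), addOrderOf t = n := by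
  constructor
  · intro h
    refine ⟨fun g => ?_, ?_⟩
    · obtain ⟨g, rfl⟩ := QuotientAddGroup.mk_surjective g
      obtain ⟨y, hy⟩ := h (lift g)
      refine ⟨(proj G y : G), ?_⟩
      rw [← QuotientAddGroup.mk_nsmul, eq_comm, QuotientAddGroup.eq_iff_sub_mem, ← proj_lift g,
        ← map_nsmul, ← map_sub]
      exact AddSubgroup.mem_map_of_mem _ hy
    -- An $n$-th part of $z$ projects to an element of order $n$: if $my-kz\in H$ then $(m-nk)z\in
    -- H$, and no nonzero multiple of $z$ is infinitely small.
    · obtain ⟨y, hy⟩ := h (z G)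
      refine ⟨(proj G y : G), (addOrderOf_eq_iff (Nat.pos_of_ne_zero hn)).2 ⟨?_, ?_⟩⟩
      · rw [← QuotientAddGroup.mk_nsmul, QuotientAddGroup.eq_zero_iff, ← map_nsmul,
          proj_mem_map_iff]
        exact ⟨1, by simpa using H.neg_mem hy⟩
      · intro m hm hm0 h0
        rw [← QuotientAddGroup.mk_nsmul, QuotientAddGroup.eq_zero_iff, ← map_nsmul,
          proj_mem_map_iff] at h0
        obtain ⟨k, hk⟩ := h0
        have h1 : (m - n * k : ℤ) • z G ∈ H := by
          convert H.add_mem (H.nsmul_mem hk n) (H.nsmul_mem hy m) using 1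
          module
        have h2 := eq_zero_of_zsmul_z_mem (hle h1)
        have h3 : n ∣ m := Int.natCast_dvd_natCast.1 ⟨k, by omega⟩
        exact absurd (Nat.le_of_dvd hm0 h3) (by omega)
  · rintro ⟨hdiv, t, ht⟩
    obtain ⟨a, rfl⟩ := QuotientAddGroup.mk_surjective t
    have hmem : ∀ k : ℕ, n ∣ k ↔ ∃ m : ℤ, k • lift a - m • z G ∈ H := by
      intro k
      rw [← proj_mem_map_iff, map_nsmul, proj_lift, ← QuotientAddGroup.eq_zero_iff,
        QuotientAddGroup.mk_nsmul, ← addOrderOf_dvd_iff_nsmul_eq_zero, ht]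
    obtain ⟨m, hm⟩ := (hmem n).1 dvd_rfl
    have hd : Int.gcd m n ≠ 0 := fun h => hn (by simpa using (Int.gcd_eq_zero_iff.1 h).2)
    obtain ⟨m', hm'⟩ := Int.gcd_dvd_left m n
    obtain ⟨n', hn'⟩ : Int.gcd m n ∣ n := Int.natCast_dvd_natCast.1 (Int.gcd_dvd_right m n)
    have hdvd : n ∣ n' := by
      refine (hmem n').2 ⟨m', hH.mem_of_nsmul_mem hd ?_⟩
      rwa [smul_sub, smul_smul, ← hn', ← natCast_zsmul (m' • z G), smul_smul, ← hm']
    have hn0 : 0 < n' := Nat.pos_of_ne_zero fun h => hn (by rw [hn', h, mul_zero])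
    -- With $n\cdot\mathrm{lift}(a)\equiv mz$, a common factor of $m$ and $n$ could be cancelled
    -- modulo $H$, making the order of $t$ smaller than $n$.
    have hg : Int.gcd m n = 1 := by
      have h1 := Nat.le_of_dvd hn0 hdvd
      have h2 : Int.gcd m n * n' ≤ 1 * n' := by omega
      have := Nat.le_of_mul_le_mul_right h2 hn0
      omega
    obtain ⟨u, v, huv⟩ := Int.isCoprime_iff_gcd_eq_one.2 hg
    -- By Bézout, $z=(um+vn)z\equiv n(u\cdot\mathrm{lift}(a)+vz)$.
    have hz : z G - n • (u • lift a + v • z G) ∈ H := by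
      convert H.zsmul_mem hm (-u) using 1
      nth_rw 1 [← one_zsmul (z G)]
      rw [← huv]
      module
    intro x
    obtain ⟨y, hy⟩ := hdiv (proj G x : G)
    obtain ⟨y, rfl⟩ := QuotientAddGroup.mk_surjective y
    rw [← QuotientAddGroup.mk_nsmul, eq_comm, QuotientAddGroup.eq_iff_sub_mem, ← proj_lift y,
      ← map_nsmul, ← map_sub, proj_mem_map_iff] at hy
    obtain ⟨k, hk⟩ := hy
    refine ⟨lift y + k • (u • lift a + v • z G), ?_⟩
    convert H.add_mem hk (H.zsmul_mem hz k) using 1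
    module

end Unwound

/-! ### Regularity of the unwound against c-regularity. -/

namespace Unwound

variable {G : Type*} [AddCommGroup G] [CircularOrder G] [IsCyclicallyOrderedAddGroup G]

theorem isCNRegular_of_isNRegular {n : ℕ} (hn : 2 ≤ n) (h : IsNRegular n (Unwound G)) :
    IsCNRegular n G := by
  intro x hx0 hx
  have hlt : ∀ i j, 1 ≤ i → i < j → j ≤ n → lift (x i) < lift (x j) := fun i j h1 h2 h3 =>
    (sbtw_zero_iff.1 (hx0 ▸ hx 0 i j h1 h2 h3)).2
  have hpos : 0 < lift (x 1) := (sbtw_zero_iff.1 (hx0 ▸ hx 0 1 2 one_pos one_lt_two hn)).1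
  obtain ⟨y, h1, h2⟩ := h (fun i => lift (x i)) hpos hlt
  have hy : 0 < y := by
    by_contra hy
    exact absurd (hpos.trans_le h1) (nsmul_nonpos (not_lt.1 hy) n).not_gt
  -- The multiples up to $ny$ stay in $[0,z)$, so projecting and lifting back loses nothing.
  have hmul : ∀ i ≤ n, lift (i • proj G y) = i • y := by
    intro i hi
    rw [← map_nsmul]
    exact lift_point (nsmul_nonneg hy.le i)
      (((nsmul_le_nsmul_left hy.le hi).trans h2).trans_lt (lift_lt_z _))
  refine ⟨proj G y, ?_, cyclicChain_of_lift_lt fun i j hij hj => ?_⟩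
  · rw [← hmul n le_rfl] at h1 h2
    rcases h1.lt_or_eq with h1 | h1
    · rcases h2.lt_or_eq with h2 | h2
      · exact Or.inr (Or.inr (sbtw_of_lift_lt h1 h2))
      · exact Or.inr (Or.inl (congrArg (proj G) h2))
    · exact Or.inl (congrArg (proj G) h1).symm
  · have hin : i < n := hij.trans_le hj
    simp only [if_pos hin]
    rw [hmul i hin.le]
    rcases hj.lt_or_eq with hj | rfl
    · rw [if_pos hj, hmul j hj.le]
      exact nsmul_lt_nsmul_left hy hij
    · rw [if_neg (lt_irrefl j)]
      exact (nsmul_lt_nsmul_left hy hij).trans_le h2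

/-- The chain $R(0,y,\dots,(n-1)y,x_n)$ says that no carry occurs before the last addition; that
addition alone may cross $z$, whence the two cases. -/
theorem _root_.IsCNRegular.exists_nsmul {n : ℕ} (hn : 2 ≤ n) (h : IsCNRegular n G)
    {x : ℕ → Unwound G} (h0 : 0 < x 1) (hx : ∀ i j, 1 ≤ i → i < j → j ≤ n → x i < x j)
    (hz : x n < z G) :
    ∃ y w : Unwound G, (n - 1) • y < x n ∧ x 1 ≤ w ∧ w ≤ x n ∧ (n • y = w ∨ n • y = z G + w) := by
  have hpos : ∀ i, 1 ≤ i → i ≤ n → 0 < x i := by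
    intro i h1 h2
    rcases h1.lt_or_eq with h1 | rfl
    · exact h0.trans (hx 1 i le_rfl h1 h2)
    · exact h0
  have hlift : ∀ i, 1 ≤ i → i ≤ n → lift (x i).point = x i := by
    intro i h1 h2
    refine lift_point (hpos i h1 h2).le ?_
    rcases h2.lt_or_eq with h2 | rfl
    · exact (hx i n h1 h2 le_rfl).trans hz
    · exact hz
  obtain ⟨y, hy, hch⟩ := h (fun i => if i = 0 then 0 else (x i).point) (if_pos rfl) <|
    cyclicChain_of_lift_lt fun i j hij hj => by
      rw [if_neg (by omega : j ≠ 0), hlift j (by omega) hj]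
      split_ifs with hi
      · exact hpos j (by omega) hj
      · rw [hlift i (by omega) (by omega)]
        exact hx i j (by omega) hij hj
  simp only [if_neg one_ne_zero, if_neg (by omega : n ≠ 0)] at hy hch
  have hmul : ∀ i < n, lift (i • y) = i • lift y := by
    intro i
    induction i with
    | zero => intro _; rw [zero_smul, zero_smul]; rfl
    | succ i ih =>
      intro hi
      rcases Nat.eq_zero_or_pos i with rfl | hi0
      · rw [zero_add, one_smul, one_smul]
      have := hch 0 i (i + 1) hi0 i.lt_succ_self hi.le
      simp only [if_pos hi, if_pos (i.lt_succ_self.trans hi), if_pos (by omega : 0 < n),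
        zero_smul, succ_nsmul y] at this
      rw [succ_nsmul, lift_add_of_sbtw this, ih (by omega), succ_nsmul]
  refine ⟨lift y, lift (n • y), ?_, ?_⟩
  · have := hch 0 (n - 1) n (by omega) (by omega) le_rfl
    simp only [if_pos (by omega : 0 < n), if_pos (by omega : n - 1 < n), if_neg (lt_irrefl n),
      zero_smul] at this
    rw [← hmul _ (by omega), ← hlift n (by omega) le_rfl]
    exact (sbtw_zero_iff.1 this).2
  have hx1n : lift (x 1).point < lift (x n).point := by
    rw [hlift 1 le_rfl (by omega), hlift n (by omega) le_rfl]
    exact hx 1 n le_rfl (by omega) le_rfl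
  have hw : lift (x 1).point ≤ lift (n • y) ∧ lift (n • y) ≤ lift (x n).point := by
    rcases hy with hy | hy | hy
    · exact ⟨hy ▸ le_rfl, hy ▸ hx1n.le⟩
    · exact ⟨hy ▸ hx1n.le, hy ▸ le_rfl⟩
    -- Cutting the circle at $0$ allows three linear readings of the cyclic relation; $x_1<x_n$
    -- leaves only one.
    · have hnot : ¬ Prec (x n).point (x 1).point := fun h' =>
        lt_asymm hx1n (lift_lt_lift.2 h')
      rw [sbtw_iff_prec] at hy
      rcases hy with hy | hy | hy
      · exact ⟨(lift_lt_lift.2 hy.1).le, (lift_lt_lift.2 hy.2).le⟩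
      · exact absurd hy.2 hnot
      · exact absurd hy.1 hnot
  rw [hlift 1 le_rfl (by omega), hlift n (by omega) le_rfl] at hw
  refine ⟨hw.1, hw.2, ?_⟩
  have hn1 : n - 1 + 1 = n := by omega
  rw [← hn1, succ_nsmul, succ_nsmul, ← hmul _ (by omega)]
  exact (lift_add_or _ _).imp_left id

theorem exists_z_sub_nsmul_mem {n : ℕ} (hn : 2 ≤ n) (h : IsCNRegular n G)
    {H : AddSubgroup (Unwound G)} (hH : IsConvex H) {e : Unwound G} (he : e ∈ H) (he0 : 0 < e)
    (hsmall : ∀ k : ℕ, k • e < z G) : ∃ y : Unwound G, z G - n • y ∈ H := by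
  -- The points $z-ne<\dots<z-e$ lie just below $z$, so $w\equiv z$ modulo $H$.
  obtain ⟨y, w, h1, h2, h3, h4⟩ := h.exists_nsmul hn (x := fun i => z G - (n + 1 - i) • e)
    (sub_pos.2 (hsmall _))
    (fun i j _ hij hj => sub_lt_sub_left (nsmul_lt_nsmul_left he0 (by omega)) _)
    (by simpa using he0)
  simp only [Nat.add_sub_cancel, Nat.add_sub_cancel_left, one_smul] at h1 h2 h3
  have hw : z G - w ∈ H := hH.mem_of_le H.zero_mem (H.nsmul_mem he n)
    (sub_nonneg.2 (h3.trans (sub_le_self _ he0.le))) (sub_le_comm.1 h2)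
  rcases h4 with h4 | h4
  · exact ⟨y, h4 ▸ hw⟩
  -- A carry would give $ny\ge 2z-ne$ together with $(n-1)y<z-e$. Eliminating $y$ yields
  -- $(n-2)z<(n-2)ne$, contrary to $ne<z$.
  exfalso
  obtain ⟨m, rfl⟩ : ∃ m, n = m + 2 := ⟨n - 2, by omega⟩
  have k1 : (m + 1) • (z G + (z G - (m + 2) • e)) ≤ (m + 1) • (m + 2) • y := by
    rw [h4]
    exact nsmul_le_nsmul_right (add_le_add_right h2 _) _
  have k2 : (m + 2) • (m + 1) • y < (m + 2) • (z G - e) :=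
    nsmul_lt_nsmul_right (by omega) h1
  rw [smul_comm] at k2
  have k3 := k1.trans_lt k2
  have k5 : m • z G < m • (m + 2) • e := by
    refine sub_neg.1 (lt_of_eq_of_lt ?_ (sub_neg.2 k3))
    module
  exact absurd (nsmul_le_nsmul_right (hsmall (m + 2)).le m) k5.not_ge

theorem isNDivisibleMod_of_isCNRegular {n : ℕ} (hn : 2 ≤ n) (h : IsCNRegular n G)
    {H : AddSubgroup (Unwound G)} (hH : IsConvex H) (hle : H ≤ infinitesimals G) (hne : H ≠ ⊥) :
    IsNDivisibleMod n H := by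
  obtain ⟨e, he, he0⟩ := exists_pos_mem hne
  have hsmall : ∀ k : ℕ, k • e < z G := fun k => by
    have := hle he k
    rwa [natCast_zsmul] at this
  obtain ⟨u, hu⟩ := exists_z_sub_nsmul_mem hn h hH he he0 hsmall
  have key : ∀ a : G, ∃ y : Unwound G, lift a - n • y ∈ H := by
    intro a
    -- If the progression $\mathrm{lift}(a)+ie$ fits below $z$, regularity applies to it, and a
    -- carry is undone by subtracting the $n$-th part `u` of $z$. Otherwise $\mathrm{lift}(a)\equiv
    -- z$ modulo $H$ and `u` itself works.
    by_cases ha : lift a + n • e < z G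
    · obtain ⟨y, w, -, h2, h3, h4⟩ := h.exists_nsmul hn (x := fun i => lift a + i • e)
        (by simpa using add_pos_of_nonneg_of_pos (lift_nonneg a) he0)
        (fun i j _ hij hj => add_lt_add_right (nsmul_lt_nsmul_left he0 hij) _) ha
      have hw : w - lift a ∈ H := hH.mem_of_le H.zero_mem (H.nsmul_mem he n)
        (sub_nonneg.2 ((le_add_of_nonneg_right (nsmul_nonneg he0.le 1)).trans h2))
        (sub_le_iff_le_add'.2 h3)
      rcases h4 with rfl | h4
      · exact ⟨y, by simpa using H.neg_mem hw⟩
      · refine ⟨y - u, ?_⟩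
        convert H.neg_mem (H.add_mem hw hu) using 1
        rw [smul_sub, h4]
        abel
    · refine ⟨u, ?_⟩
      have hza : z G - lift a ∈ H := hH.mem_of_le H.zero_mem (H.nsmul_mem he n)
        (sub_nonneg.2 (lift_lt_z a).le) (sub_le_iff_le_add'.2 (not_lt.1 ha))
      convert H.sub_mem hu hza using 1
      abel
  intro x
  obtain ⟨k, a, rfl⟩ := exists_zsmul_z_add_lift x
  obtain ⟨y, hy⟩ := key a
  refine ⟨k • u + y, ?_⟩
  convert H.add_mem (H.zsmul_mem hu k) hy using 1
  module

/-! ### Proper c-convex subgroups as images of convex subgroups. -/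

theorem IsConvex.le_infinitesimals {H : AddSubgroup (Unwound G)} (hH : IsConvex H) (hne : H ≠ ⊤) :
    H ≤ infinitesimals G :=
  isGreatest_infinitesimals.2 ⟨hH, hne⟩

theorem isConvex_infinitesimals : IsConvex (infinitesimals G) :=
  isGreatest_infinitesimals.1.1

theorem linearPart_eq_map : linearPart G = (infinitesimals G).map (proj G) := by
  rw [linearPart, convexPart_eq, AddMonoidHom.range_comp, AddSubgroup.range_subtype]

theorem lift_neg {b : G} (hb : b ≠ 0) : lift (-b) = z G - lift b := by
  rw [eq_sub_iff_add_eq]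
  rcases lift_add_or (-b) b with h | h
  · rw [neg_add_cancel, lift_zero, add_eq_zero_iff_of_nonneg (lift_nonneg _) (lift_nonneg _)] at h
    exact absurd (congrArg (proj G) h.2) hb
  · rw [h, neg_add_cancel, lift_zero, add_zero]

theorem sbtw_zero_neg_iff {b : G} : sbtw 0 b (-b) ↔ 0 < lift b ∧ 2 • lift b < z G := by
  rw [sbtw_zero_iff]
  refine and_congr_right fun h => ?_
  rw [lift_neg, lt_sub_iff_add_lt, two_nsmul]
  rintro rfl
  exact lt_irrefl _ h

theorem isProperCConvex_map {H : AddSubgroup (Unwound G)} (hH : IsConvex H)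
    (hle : H ≤ infinitesimals G) (hne : H ≠ ⊥) : IsProperCConvex (H.map (proj G)) := by
  have hinj : ∀ h ∈ H, proj G h = 0 → h = 0 := by
    intro h hh h0
    have e := eq_zsmul_z_of_proj_eq_zero h0
    have := eq_zero_of_zsmul_z_mem (e ▸ hle hh)
    rw [e, this, zero_smul]
  refine ⟨⟨?_, ?_⟩, ?_, ?_⟩
  · rintro _ ⟨h, hh, rfl⟩ h0 e
    refine h0 ?_
    have h2 : 2 • h = 0 := hinj _ (H.nsmul_mem hh 2) (by
      rw [map_nsmul, two_nsmul]
      nth_rw 2 [e]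
      rw [add_neg_cancel])
    rw [(nsmul_eq_zero_iff_right two_ne_zero).1 h2, map_zero]
  · rintro a _ ⟨h, hh, rfl⟩ hb hab
    rw [sbtw_zero_neg_iff] at hb
    rw [sbtw_zero_iff] at hab
    have hhz : h < z G := by simpa using hle hh 1
    -- A negative infinitely small $h$ has its representative $z+h$ just below $z$, too large for
    -- its double to be less than $z$.
    have hpos : 0 ≤ h := by
      by_contra hneg
      push Not at hneg
      have hnz : -h < z G := by simpa using hle hh (-1)
      have h0 : proj G (-h) ≠ 0 := fun h0 => hneg.ne (by simpa using hinj _ (H.neg_mem hh) h0)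
      have e : lift (proj G h) = z G + h := by
        have h1 : lift (-proj G (-h)) = z G - lift (proj G (-h)) := lift_neg h0
        rw [map_neg, neg_neg, ← map_neg] at h1
        rw [h1]
        have h2 : lift (proj G (-h)) = -h := lift_point (neg_nonneg.2 hneg.le) hnz
        rw [h2, sub_neg_eq_add]
      rw [e, smul_add, two_nsmul, add_assoc, add_lt_iff_neg_left] at hb
      have h2 := hle hh (-2)
      rw [neg_smul] at h2
      have h3 : (2 : ℤ) • h = 2 • h := by module
      rw [h3, neg_lt_iff_pos_add'] at h2
      rw [add_comm] at h2
      exact lt_asymm hb.2 h2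
    have e : lift (proj G h) = h := lift_point hpos hhz
    rw [e] at hab
    exact ⟨lift a, hH _ _ hh hab.1.le hab.2.le, rfl⟩
  · obtain ⟨h, hh, h0⟩ := exists_pos_mem hne
    intro e
    have : proj G h ∈ H.map (proj G) := ⟨h, hh, rfl⟩
    rw [e, AddSubgroup.mem_bot] at this
    exact h0.ne' (hinj h hh this)
  · intro e
    rw [eq_top_iff, ← e, linearPart_eq_map]
    exact AddSubgroup.map_mono hle

theorem exists_convex_of_isProperCConvex {K : AddSubgroup G} (hK : IsProperCConvex K) :
    ∃ H : AddSubgroup (Unwound G), IsConvex H ∧ H ≤ infinitesimals G ∧ H ≠ ⊥ ∧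
      H.map (proj G) = K := by
  obtain ⟨⟨hK1, hK2⟩, hbot, htop⟩ := hK
  have hclose : ∀ {x y : Unwound G}, proj G x ∈ K → 0 ≤ y → y ≤ x → 2 • x < z G →
      proj G y ∈ K := by
    intro x y hx h0 hyx h2
    rcases h0.lt_or_eq with h0 | rfl
    · rcases hyx.lt_or_eq with hyx | rfl
      · have hx0 := h0.trans hyx
        have hxz : x < z G := lt_of_le_of_lt
          (by simpa using nsmul_le_nsmul_left hx0.le one_le_two) h2
        have ex : lift (proj G x) = x := lift_point hx0.le hxz
        have ey : lift (proj G y) = y := lift_point h0.le (hyx.trans hxz)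
        refine hK2 _ _ hx (sbtw_zero_neg_iff.2 ?_) (sbtw_zero_iff.2 ?_)
        · rw [ex]
          exact ⟨hx0, h2⟩
        · rw [ex, ey]
          exact ⟨h0, hyx⟩
      · exact hx
    · rw [map_zero]
      exact K.zero_mem
  have hsmall : ∀ b ∈ K, sbtw 0 b (-b) → b ∈ linearPart G := by
    intro b hb hs
    obtain ⟨h0, h2⟩ := sbtw_zero_neg_iff.1 hs
    by_cases hinf : ∀ k : ℕ, k • lift b < z G
    · rw [linearPart_eq_map]
      refine ⟨lift b, fun k => ?_, rfl⟩
      obtain ⟨m, rfl | rfl⟩ := k.eq_nat_or_neg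
      · rw [natCast_zsmul]
        exact hinf m
      · rw [neg_smul, natCast_zsmul]
        exact (neg_nonpos.2 (nsmul_nonneg h0.le m)).trans_lt z_pos
    · push Not at hinf
      obtain ⟨k, hk⟩ := hinf
      -- Some multiple of $b$ reaches $z$, so every $a$ is a multiple of $b$ plus a remainder in
      -- $[0,b)$, which c-convexity puts in $K$. Properness then forces $l(G)=G$.
      have : K = ⊤ := by
        rw [eq_top_iff]
        intro a _
        obtain ⟨m, hm1, hm2⟩ := exists_zsmul_le_lt (x := lift a) (k := k) h0
          (by rw [abs_of_nonneg (lift_nonneg a)]; exact (lift_lt_z a).le.trans hk)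
        rw [add_smul, one_smul] at hm2
        have h3 : proj G (lift a - m • lift b) ∈ K :=
          hclose (x := lift b) hb (sub_nonneg.2 hm1) (sub_le_iff_le_add'.2 hm2.le) h2
        rw [map_sub, map_zsmul, proj_lift, proj_lift] at h3
        simpa using K.add_mem h3 (K.zsmul_mem hb m)
      rw [htop this]
      exact AddSubgroup.mem_top b
  have hKle : K ≤ linearPart G := by
    intro b hb
    by_cases h0 : b = 0
    · rw [h0]
      exact zero_mem _
    rcases sbtw_or (Ne.symm h0) (hK1 b hb h0) (neg_ne_zero.2 h0) with h | h
    · exact hsmall b hb h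
    · rw [← neg_mem_iff]
      refine hsmall _ (K.neg_mem hb) ?_
      rw [neg_neg]
      exact h.cyclic_right
  have hmap : (infinitesimals G ⊓ K.comap (proj G)).map (proj G) = K := by
    refine le_antisymm (AddSubgroup.map_le_iff_le_comap.2 inf_le_right) fun b hb => ?_
    have h := hKle hb
    rw [linearPart_eq_map] at h
    obtain ⟨x, hx, rfl⟩ := h
    exact ⟨x, ⟨hx, hb⟩, rfl⟩
  refine ⟨_, ?_, inf_le_left, ?_, hmap⟩
  · rintro x y ⟨hx, hxK⟩ h0 hyx
    refine ⟨isConvex_infinitesimals x y hx h0 hyx, hclose hxK h0 hyx ?_⟩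
    have := hx 2
    rwa [← Nat.cast_ofNat (R := ℤ), natCast_zsmul] at this
  · intro e
    rw [e, AddSubgroup.map_bot] at hmap
    exact hbot hmap.symm

end Unwound

/-! ### The linear part inside the unwound, and the equivalence. -/

theorem linearPartEquiv_symm_strictMono {G : Type*} [AddCommGroup G] [CircularOrder G]
    [IsCyclicallyOrderedAddGroup G] :
    StrictMono ((Unwound.convexPart G).subtype.comp
      (linearPartEquiv G).symm.toAddMonoidHom) := fun _ _ h => h

theorem range_linearPartEquiv_symm {G : Type*} [AddCommGroup G] [CircularOrder G]
    [IsCyclicallyOrderedAddGroup G] :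
    ((Unwound.convexPart G).subtype.comp (linearPartEquiv G).symm.toAddMonoidHom).range =
      Unwound.infinitesimals G := by
  rw [AddMonoidHom.range_comp, AddMonoidHom.range_eq_top.2 (linearPartEquiv G).symm.surjective,
    ← AddMonoidHom.range_eq_map, AddSubgroup.range_subtype, Unwound.convexPart_eq]

theorem mainTheorem6 {G : Type*} [AddCommGroup G] [CircularOrder G] [IsCyclicallyOrderedAddGroup G]
    (n : ℕ) (hn : 2 ≤ n) :
    List.TFAE [
      IsNRegular n (Unwound G),
      IsCNRegular n G,
      IsCArchimedean G ∨
        (IsNRegular n (linearPart G) ∧ IsNDivisible n (G ⧸ linearPart G) ∧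
          ∃ t : G ⧸ linearPart G, addOrderOf t = n),
      ∀ H : AddSubgroup G, IsProperCConvex H → IsCNDivisible n (G ⧸ H)] := by
  have hn0 : n ≠ 0 := by omega
  tfae_have 1 → 2 := Unwound.isCNRegular_of_isNRegular hn
  tfae_have 2 → 4 := by
    intro h K hK
    obtain ⟨H, hH, hle, hne, rfl⟩ := Unwound.exists_convex_of_isProperCConvex hK
    rw [isCNDivisible_iff hn0, ← Unwound.isNDivisibleMod_iff hn0 hH hle]
    exact Unwound.isNDivisibleMod_of_isCNRegular hn h hH hle hne
  tfae_have 4 → 1 := by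
    intro h
    refine isNRegular_of_isNDivisibleMod hn fun H hH hne => ?_
    -- Divisibility modulo the whole group is vacuous; the other convex subgroups correspond to
    -- proper c-convex ones.
    by_cases htop : H = ⊤
    · exact fun x => ⟨0, htop ▸ AddSubgroup.mem_top _⟩
    have hle := hH.le_infinitesimals htop
    rw [Unwound.isNDivisibleMod_iff hn0 hH hle, ← isCNDivisible_iff hn0]
    exact h _ (Unwound.isProperCConvex_map hH hle hne)
  have hlin : IsNDivisibleMod n (Unwound.infinitesimals G) ↔
      IsNDivisible n (G ⧸ linearPart G) ∧ ∃ t : G ⧸ linearPart G, addOrderOf t = n := by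
    rw [Unwound.isNDivisibleMod_iff hn0 Unwound.isConvex_infinitesimals le_rfl,
      Unwound.linearPart_eq_map]
  tfae_have 1 → 3 := by
    intro h
    refine or_iff_not_imp_left.2 fun harch => ⟨?_, hlin.1 ?_⟩
    · exact h.of_isConvex_range hn linearPartEquiv_symm_strictMono
        (range_linearPartEquiv_symm (G := G) ▸ Unwound.isConvex_infinitesimals)
    · refine h.isNDivisibleMod Unwound.isConvex_infinitesimals fun e => harch ?_
      rw [IsCArchimedean, Unwound.linearPart_eq_map, e, AddSubgroup.map_bot]
  tfae_have 3 → 4 := by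
    intro h K hK
    obtain ⟨H, hH, hle, hne, rfl⟩ := Unwound.exists_convex_of_isProperCConvex hK
    rcases h with harch | ⟨hreg, hdiv⟩
    -- A c-archimedean group has no proper c-convex subgroup.
    · refine absurd ?_ hK.2.1
      rw [← le_bot_iff, ← (show linearPart G = ⊥ from harch), Unwound.linearPart_eq_map]
      exact AddSubgroup.map_mono hle
    rw [isCNDivisible_iff hn0, ← Unwound.isNDivisibleMod_iff hn0 hH hle]
    rw [← range_linearPartEquiv_symm] at hle hlin
    exact hreg.isNDivisibleMod_of_range linearPartEquiv_symm_strictMono (hlin.2 hdiv) hH hle hne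
  tfae_finish
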